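/- Let $n\ge 0$ be an integer, $S=\{1,\dots,n\}$, and let $K>1$ be real. For a unit vector $|\psi\rangle\in(\mathbb C^2)^{\otimes n}$ (a pure state of $n$ qubits labelled by $S$) and $\alpha\subseteq S$, let $\rho_\alpha=\operatorname{Tr}_{S\setminus\alpha}|\psi\rangle\langle\psi|$ be the reduced density matrix on the qubits in $\alpha$, with $\operatorname{Tr}(\rho_\varnothing^K)=1$. For $s\subseteq S$ the generalized concentratable entanglement (GCE) is $$\mathcal C^{(K)}_{|\psi\rangle}(s)=\frac1{K-1}\Bigl(1-\frac1{2^{|s|}}\sum_{\alpha\subseteq s}\operatorname{Tr}(\rho_\alpha^K)\Bigr).$$ The following hold. 1. (Monotonicity on average under LOCC.) Regard each qubit as held by a separate party. Consider any LOCC protocol with finitely many rounds and finitely many measurement outcomes, in which local ancillas of arbitrary finite dimension and the forgetting of classical information are allowed, and which announces a classical label $l$ from a finite set. Suppose that it maps the pure $n$-qubit state $|\psi\rangle$ to the pure $n$-qubit states $|\varphi_l\rangle$ with probabilities $p_l$ (that is, for each $l$ the unnormalized output state conditioned on $l$ is $p_l|\varphi_l\rangle\langle\varphi_l|$). Then for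 every $s\subseteq S$ $$\sum_l p_l\,\mathcal C^{(K)}_{|\varphi_l\rangle}(s)\le\mathcal C^{(K)}_{|\psi\rangle}(s).$$ 2. $\mathcal C^{(K)}_{|\psi\rangle}(s)=0$ for every fully product state $|\psi\rangle=\bigotimes_{j=1}^n|\phi_j\rangle$ and every $s\subseteq S$. 3. (Continuity.) If $|\psi\rangle,|\psi'\rangle$ are pure $n$-qubit states with trace distance $\frac12\bigl\||\psi\rangle\langle\psi|-|\psi'\rangle\langle\psi'|\bigr\|_1\le\varepsilon$, then for every $s\subseteq S$ $$\bigl|\mathcal C^{(K)}_{|\psi\rangle}(s)-\mathcal C^{(K)}_{|\psi'\rangle}(s)\bigr|\le\frac{2K}{K-1}\,\varepsilon.$$ 4. $\mathcal C^{(K)}_{|\psi\rangle}(S)=\mathcal C^{(K)}_{|\psi\rangle}(S\setminus\{n_0\})$ for every pure $n$-qubit state $|\psi\rangle$ and every $n_0\in S$. -/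

import Mathlib

open scoped Matrix

noncomputable section

namespace GCE

/-- Kets of an `n`-partite system whose `i`-th party holds a `d i`-dimensional Hilbert space,
written in the product basis. -/
abbrev Ket {n : ℕ} (d : Fin n → ℕ) : Type := EuclideanSpace ℂ (∀ i, Fin (d i))

/-- Operators on the same space, as matrices in the product basis. -/
abbrev Op {n : ℕ} (d : Fin n → ℕ) : Type := Matrix (∀ i, Fin (d i)) (∀ i, Fin (d i)) ℂ

/-- The local dimensions of `n` qubits. -/
abbrev qubits (n : ℕ) : Fin n → ℕ := fun _ => 2

/-- The operator `|ψ⟩⟨ψ|`. -/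
def proj {n : ℕ} {d : Fin n → ℕ} (ψ : Ket d) : Op d :=
  Matrix.of fun x y => ψ x * star (ψ y)

/-- The basis label of the whole system with entries `a` on `α` and `e` off `α`. -/
def glue {n : ℕ} {d : Fin n → ℕ} (α : Finset (Fin n))
    (a : ∀ i : {i // i ∈ α}, Fin (d i)) (e : ∀ i : {i // i ∉ α}, Fin (d i)) :
    ∀ i, Fin (d i) :=
  fun i => if h : i ∈ α then a ⟨i, h⟩ else e ⟨i, h⟩

/-- The reduced operator on the parties in `α`: the partial trace over the parties off `α`.
For `α = ∅` it is the `1 × 1` matrix whose entry is the trace of `ρ`. -/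
def reduced {n : ℕ} {d : Fin n → ℕ} (ρ : Op d) (α : Finset (Fin n)) :
    Matrix (∀ i : {i // i ∈ α}, Fin (d i)) (∀ i : {i // i ∈ α}, Fin (d i)) ℂ :=
  Matrix.of fun a b => ∑ e : (∀ i : {i // i ∉ α}, Fin (d i)), ρ (glue α a e) (glue α b e)

/-- `Tr (ρ ^ K)` for a positive semidefinite matrix `ρ` and a real exponent `K`; the power is taken
by the functional calculus of Hermitian matrices. -/
def trPow {ι : Type*} [Fintype ι] [DecidableEq ι] (K : ℝ) (ρ : Matrix ι ι ℂ) : ℝ :=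
  (cfc (fun x : ℝ => x ^ K) ρ).trace.re

/-- The generalized concentratable entanglement of `ψ` on the set `s` of parties. -/
def gce {n : ℕ} {d : Fin n → ℕ} (K : ℝ) (ψ : Ket d) (s : Finset (Fin n)) : ℝ :=
  1 / (K - 1) * (1 - 1 / 2 ^ s.card * ∑ α ∈ s.powerset, trPow K (reduced (proj ψ) α))

/-- The trace norm `‖A‖₁ = Tr √(A† A)`. -/
def traceNorm {ι : Type*} [Fintype ι] [DecidableEq ι] (A : Matrix ι ι ℂ) : ℝ :=
  (cfc Real.sqrt (Aᴴ * A)).trace.re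

/-- The trace distance of two pure states. -/
def traceDist {n : ℕ} {d : Fin n → ℕ} (ψ φ : Ket d) : ℝ :=
  1 / 2 * traceNorm (proj ψ - proj φ)

/-- The product ket `⊗ j, φ j`. -/
def productKet {n : ℕ} {d : Fin n → ℕ} (φ : ∀ j, EuclideanSpace ℂ (Fin (d j))) : Ket d :=
  WithLp.toLp 2 fun x => ∏ j, φ j (x j)

/-- The product operator `⊗ i, A i`. -/
def productOp {n : ℕ} {d d' : Fin n → ℕ} (A : ∀ i, Matrix (Fin (d' i)) (Fin (d i)) ℂ) :
    Matrix (∀ i, Fin (d' i)) (∀ i, Fin (d i)) ℂ :=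
  Matrix.of fun x y => ∏ i, A i (x i) (y i)

/-- LOCC protocols with finitely many rounds among `n` parties, from local dimensions given by the
last argument to local dimensions `dout`, with classical output in `ι`.

In a step, party `j` performs a measurement with Kraus operators `A k j`, where `k` ranges over
finitely many outcomes, and broadcasts the outcome `k`; each other party `i` then applies a local
isometry `A k i` (the identity, for instance), and the parties go on with a protocol that may depend
on `k`. Local dimensions may change, so that local ancillas may be added and local subsystems
may be discarded. When the protocol stops, a label is announced; several branches may carry the same
label, which is how classical information is forgotten. -/
inductive LOCC {n : ℕ} (ι : Type*) (dout : Fin n → ℕ) : (Fin n → ℕ) → Type _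
  | done (label : ι) : LOCC ι dout dout
  | step {d : Fin n → ℕ} (j : Fin n) {m : ℕ} (d' : Fin m → Fin n → ℕ)
      (A : ∀ (k : Fin m) (i : Fin n), Matrix (Fin (d' k i)) (Fin (d i)) ℂ)
      (measurement : ∑ k, (A k j)ᴴ * A k j = 1)
      (isometry : ∀ k i, i ≠ j → (A k i)ᴴ * A k i = 1)
      (next : ∀ k, LOCC ι dout (d' k)) : LOCC ι dout d

/-- The unnormalized output state of a protocol on the input `ρ`, conditioned on the label `l`: its
trace is the probability of `l`, and divided by its trace it is the state that the parties
then hold. -/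
def LOCC.output {n : ℕ} {ι : Type*} [DecidableEq ι] {dout : Fin n → ℕ} :
    {d : Fin n → ℕ} → LOCC ι dout d → Op d → ι → Op dout
  | _, .done label, ρ, l => if l = label then ρ else 0
  | _, .step _ _ A _ _ next, ρ, l =>
      ∑ k, (next k).output (productOp (A k) * ρ * (productOp (A k))ᴴ) l

end GCE

end

noncomputable section

namespace GCE

open scoped ComplexOrder

/-! ### Traces of functions of Hermitian matrices -/

section Spectral

variable {ι κ : Type*} [Fintype ι] [DecidableEq ι] [Fintype κ] [DecidableEq κ]

/-! Everything reduces to the purities `Tr ρ_α ^ K` of the reduced states. Writing the coefficients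
of `ψ` as a matrix `M` for the cut into `α` and its complement gives `ρ_α = M Mᴴ`. The other reduced
state is the transpose of `Mᴴ M`, which has the same spectrum up to zeros.

Monotonicity is convexity. Put `h(B) = Tr B ^ K / (Tr B) ^ (K - 1)` (`homTrPow`). Bernoulli's
inequality on eigenvalues gives a Klein inequality, hence a linear functional below `h` that touches
it along the ray of a given density matrix, so `h` is subadditive (`homTrPow_sum_le`). A measurement
off `α` splits `ρ_α` into a sum of branch states, up to isometries on `α`. One inside `α` is handled
by exchanging the two sides of the cut. So purities do not decrease on average, and induction over
the protocol applies: since a pure state is extremal, every branch merged into the label `l` already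
carries a multiple of `φ l` (`eq_smul_proj_of_sum_eq`).

On product states every `M` has rank one, so every purity is 1. Continuity is the same Klein
inequality at `t = 1`, with the derivative `K x ^ (K - 1)` between 0 and `K` on the spectrum. The
last claim pairs each set with its complement. -/

theorem continuousOn_spectrum (A : Matrix ι ι ℂ) (f : ℝ → ℝ) : ContinuousOn f (spectrum ℝ A) :=
  A.finite_real_spectrum.continuousOn f

/-- The traces of products of functions of two Hermitian matrices are weighted double sums over the
eigenvalues, with nonnegative weights that depend on the matrices only. -/
theorem exists_overlap {A B : Matrix ι ι ℂ} (hA : A.IsHermitian) (hB : B.IsHermitian) :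
    ∃ w : ι → ι → ℝ, (∀ i j, 0 ≤ w i j) ∧ ∀ f g : ℝ → ℝ,
      (cfc f A * cfc g B).trace.re =
        ∑ i, ∑ j, w i j * (f (hA.eigenvalues i) * g (hB.eigenvalues j)) := by
  set U : Matrix ι ι ℂ := (hA.eigenvectorUnitary).1 with hU
  set V : Matrix ι ι ℂ := (hB.eigenvectorUnitary).1 with hV
  set W : Matrix ι ι ℂ := Uᴴ * V with hW
  refine ⟨fun i j => Complex.normSq (W i j), fun i j => Complex.normSq_nonneg _, fun f g => ?_⟩
  have key : (cfc f A * cfc g B).trace =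
      ((Matrix.diagonal (fun i => (f (hA.eigenvalues i) : ℂ)) * W) *
        (Matrix.diagonal (fun i => (g (hB.eigenvalues i) : ℂ)) * Wᴴ)).trace := by
    rw [hA.cfc_eq, hB.cfc_eq, Matrix.IsHermitian.cfc, Matrix.IsHermitian.cfc,
      Unitary.conjStarAlgAut_apply, Unitary.conjStarAlgAut_apply, hW, Matrix.conjTranspose_mul,
      Matrix.conjTranspose_conjTranspose]
    simp only [← hU, ← hV, Matrix.star_eq_conjTranspose]
    rw [Matrix.mul_assoc U, Matrix.mul_assoc U, Matrix.trace_mul_comm U]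
    simp only [Matrix.mul_assoc]
    rfl
  rw [key, Matrix.trace, Complex.re_sum]
  refine Finset.sum_congr rfl fun i _ => ?_
  rw [Matrix.diag_apply, Matrix.mul_apply, Complex.re_sum]
  refine Finset.sum_congr rfl fun j _ => ?_
  rw [Matrix.diagonal_mul, Matrix.diagonal_mul, Matrix.conjTranspose_apply]
  have : (f (hA.eigenvalues i) : ℂ) * W i j * ((g (hB.eigenvalues j) : ℂ) * star (W i j)) =
      ((Complex.normSq (W i j) * (f (hA.eigenvalues i) * g (hB.eigenvalues j)) : ℝ) : ℂ) := by
    push_cast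
    rw [Complex.normSq_eq_conj_mul_self]
    simp only [RCLike.star_def]
    ring
  rw [this, Complex.ofReal_re]

theorem trace_cfc_re {A : Matrix ι ι ℂ} (hA : A.IsHermitian) (f : ℝ → ℝ) :
    (cfc f A).trace.re = ∑ i, f (hA.eigenvalues i) := by
  rw [hA.cfc_eq, Matrix.IsHermitian.cfc, Unitary.conjStarAlgAut_apply,
    Matrix.trace_mul_cycle, Unitary.coe_star_mul_self, Matrix.one_mul, Matrix.trace_diagonal,
    Complex.re_sum]
  rfl

theorem posSemidef_cfc {A : Matrix ι ι ℂ} (hA : A.IsHermitian) {f : ℝ → ℝ}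
    (hf : ∀ i, 0 ≤ f (hA.eigenvalues i)) : (cfc f A).PosSemidef := by
  rw [hA.cfc_eq, Matrix.IsHermitian.cfc, Unitary.conjStarAlgAut_apply]
  refine Matrix.PosSemidef.mul_mul_conjTranspose_same (Matrix.PosSemidef.diagonal fun i => ?_) _
  exact Complex.zero_le_real.2 (hf i)

/-- A Hermitian matrix is a difference of positive semidefinite ones, the first of which has trace
at most the trace norm. -/
theorem exists_posSemidef_sub {A : Matrix ι ι ℂ} (hA : A.IsHermitian) :
    ∃ P N : Matrix ι ι ℂ, P.PosSemidef ∧ N.PosSemidef ∧ A = P - N ∧ P.trace.re ≤ traceNorm A := by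
  refine ⟨cfc (fun x => max x 0) A, cfc (fun x => max (-x) 0) A,
    posSemidef_cfc hA fun i => le_max_right _ _, posSemidef_cfc hA fun i => le_max_right _ _, ?_, ?_⟩
  · rw [← cfc_sub _ _ A (continuousOn_spectrum _ _) (continuousOn_spectrum _ _)]
    conv_lhs => rw [← cfc_id' ℝ A hA.isSelfAdjoint]
    refine cfc_congr fun x _ => ?_
    rcases le_total x 0 with h | h <;> simp [h]
  -- Here `Aᴴ * A = A²`, so the trace norm is the sum of the absolute eigenvalues, which dominate
  -- their positive parts.
  · have hsq : Aᴴ * A = cfc (fun x : ℝ => x * x) A := by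
      rw [cfc_mul _ _ A (continuousOn_spectrum _ _) (continuousOn_spectrum _ _),
        cfc_id' ℝ A hA.isSelfAdjoint, hA.eq]
    rw [traceNorm, hsq, ← cfc_comp' Real.sqrt (fun x : ℝ => x * x) A
      ((A.finite_real_spectrum.image _).continuousOn _) (continuousOn_spectrum _ _)
      hA.isSelfAdjoint, trace_cfc_re hA, trace_cfc_re hA]
    refine Finset.sum_le_sum fun i _ => ?_
    rw [Real.sqrt_mul_self_eq_abs]
    exact max_le (le_abs_self _) (abs_nonneg _)

theorem trace_cfc_mul_le {A B : Matrix ι ι ℂ} (hA : A.IsHermitian) (hB : B.PosSemidef)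
    {f g : ℝ → ℝ} (h : ∀ i, f (hA.eigenvalues i) ≤ g (hA.eigenvalues i)) :
    (cfc f A * B).trace.re ≤ (cfc g A * B).trace.re := by
  obtain ⟨w, hw, H⟩ := exists_overlap hA hB.isHermitian
  have hid := cfc_id' ℝ B hB.isHermitian.isSelfAdjoint
  have h1 := H f (fun x => x)
  have h2 := H g (fun x => x)
  rw [hid] at h1 h2
  rw [h1, h2]
  exact Finset.sum_le_sum fun i _ => Finset.sum_le_sum fun j _ =>
    mul_le_mul_of_nonneg_left (mul_le_mul_of_nonneg_right (h i) (hB.eigenvalues_nonneg j)) (hw i j)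

/-- A real function agrees on the spectra of two matrices with a polynomial. -/
theorem exists_polynomial_cfc {f : ℝ → ℝ} (hf : f 0 = 0) {A : Matrix ι ι ℂ} {B : Matrix κ κ ℂ}
    (hA : A.IsHermitian) (hB : B.IsHermitian) :
    ∃ r : Polynomial ℝ, cfc f A = A * Polynomial.aeval A r ∧ cfc f B = B * Polynomial.aeval B r := by
  classical
  -- The extra node 0 makes the constant term vanish, so that a factor `X` splits off the
  -- interpolant.
  let s : Finset ℝ := insert 0 (A.finite_real_spectrum.toFinset ∪ B.finite_real_spectrum.toFinset)
  let q := Lagrange.interpolate s id f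
  have hq : ∀ x ∈ s, q.eval x = f x := fun x hx =>
    Lagrange.eval_interpolate_at_node f (Function.injective_id.injOn) hx
  have h0 : q.coeff 0 = 0 := by
    rw [Polynomial.coeff_zero_eq_eval_zero, hq 0 (by simp [s]), hf]
  have hX : Polynomial.X * q.divX = q := by
    have := Polynomial.X_mul_divX_add q
    rwa [h0, map_zero, add_zero] at this
  refine ⟨q.divX, ?_, ?_⟩
  · have h : cfc f A = cfc (fun x => q.eval x) A :=
      cfc_congr fun x hx => (hq x (by simp [s, hx])).symm
    rw [h, cfc_polynomial q A hA.isSelfAdjoint]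
    conv_lhs => rw [← hX]
    simp
  · have h : cfc f B = cfc (fun x => q.eval x) B :=
      cfc_congr fun x hx => (hq x (by simp [s, hx])).symm
    rw [h, cfc_polynomial q B hB.isSelfAdjoint]
    conv_lhs => rw [← hX]
    simp

theorem aeval_mul_intertwine (X : Matrix ι κ ℂ) (Y : Matrix κ ι ℂ) (r : Polynomial ℝ) :
    Polynomial.aeval (X * Y) r * X = X * Polynomial.aeval (Y * X) r := by
  have hpow : ∀ k : ℕ, (X * Y) ^ k * X = X * (Y * X) ^ k := by
    intro k
    induction k with
    | zero => simp
    | succ k ih => rw [pow_succ', pow_succ', Matrix.mul_assoc, ih]; simp only [Matrix.mul_assoc]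
  induction r using Polynomial.induction_on' with
  | add p q hp hq => simp [Matrix.add_mul, Matrix.mul_add, hp, hq]
  | monomial k a =>
    rw [Polynomial.aeval_monomial, Polynomial.aeval_monomial, Algebra.algebraMap_eq_smul_one,
      Algebra.algebraMap_eq_smul_one, smul_mul_assoc, smul_mul_assoc, one_mul, one_mul,
      Matrix.smul_mul, Matrix.mul_smul, hpow]

theorem aeval_transpose (A : Matrix ι ι ℂ) (r : Polynomial ℝ) :
    Polynomial.aeval Aᵀ r = (Polynomial.aeval A r)ᵀ := by
  induction r using Polynomial.induction_on' with
  | add p q hp hq => simp [hp, hq]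
  | monomial k a =>
    simp [Polynomial.aeval_monomial, Algebra.algebraMap_eq_smul_one, Matrix.transpose_pow]

/-- The two products share their nonzero spectrum, and `f 0 = 0` hides the surplus zeros. With `f(x)
= x r(x)` on both spectra, this is cyclicity of the trace and `r(XY) X = X r(YX)`. -/
theorem trace_cfc_mul_comm {f : ℝ → ℝ} (hf : f 0 = 0) (X : Matrix ι κ ℂ) (Y : Matrix κ ι ℂ)
    (h₁ : (X * Y).IsHermitian) (h₂ : (Y * X).IsHermitian) :
    (cfc f (X * Y)).trace = (cfc f (Y * X)).trace := by
  obtain ⟨r, e₁, e₂⟩ := exists_polynomial_cfc hf h₁ h₂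
  rw [e₁, e₂, Matrix.trace_mul_comm, ← Matrix.mul_assoc, aeval_mul_intertwine,
    Matrix.trace_mul_comm, ← Matrix.mul_assoc]

theorem trace_cfc_transpose {f : ℝ → ℝ} (hf : f 0 = 0) {A : Matrix ι ι ℂ} (hA : A.IsHermitian) :
    (cfc f Aᵀ).trace = (cfc f A).trace := by
  obtain ⟨r, e₁, e₂⟩ := exists_polynomial_cfc hf hA.transpose hA
  rw [e₁, e₂, aeval_transpose, ← Matrix.transpose_mul, Matrix.trace_transpose,
    Matrix.trace_mul_comm]

end Spectral

/-! ### Klein's inequality and convexity of the purity -/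

section TrPow

variable {ι κ : Type*} [Fintype ι] [DecidableEq ι] [Fintype κ] [DecidableEq κ] {K : ℝ}

theorem trPow_mul_comm (hK : 1 < K) (X : Matrix ι κ ℂ) (Y : Matrix κ ι ℂ)
    (h₁ : (X * Y).IsHermitian) (h₂ : (Y * X).IsHermitian) : trPow K (X * Y) = trPow K (Y * X) := by
  rw [trPow, trPow, trace_cfc_mul_comm (f := fun x : ℝ => x ^ K) (Real.zero_rpow (by linarith)) X Y h₁ h₂]

theorem trPow_transpose (hK : 1 < K) {A : Matrix ι ι ℂ} (hA : A.IsHermitian) :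
    trPow K Aᵀ = trPow K A := by
  rw [trPow, trPow, trace_cfc_transpose (f := fun x : ℝ => x ^ K) (Real.zero_rpow (by linarith)) hA]

theorem trPow_transpose_mul_conjTranspose (hK : 1 < K) (M : Matrix ι κ ℂ) :
    trPow K (Mᵀ * Mᵀᴴ) = trPow K (M * Mᴴ) := by
  have h : Mᵀ * Mᵀᴴ = (Mᴴ * M)ᵀ := by
    rw [Matrix.transpose_mul]; rfl
  rw [h, trPow_transpose hK (Matrix.isHermitian_conjTranspose_mul_self M),
    trPow_mul_comm hK _ _ (Matrix.isHermitian_conjTranspose_mul_self M)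
      (Matrix.isHermitian_mul_conjTranspose_self M)]

theorem trPow_isometry (hK : 1 < K) {A : Matrix ι ι ℂ} (hA : A.IsHermitian) {V : Matrix κ ι ℂ}
    (hV : Vᴴ * V = 1) : trPow K (V * A * Vᴴ) = trPow K A := by
  have h : Vᴴ * (V * A) = A := by rw [← Matrix.mul_assoc, hV, Matrix.one_mul]
  rw [trPow_mul_comm hK _ _ (Matrix.isHermitian_mul_mul_conjTranspose V hA) (by rwa [h]), h]

theorem trPow_eq_sum_eigenvalues {A : Matrix ι ι ℂ} (hA : A.IsHermitian) :
    trPow K A = ∑ i, hA.eigenvalues i ^ K :=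
  trace_cfc_re hA _

theorem trPow_nonneg {A : Matrix ι ι ℂ} (hA : A.PosSemidef) : 0 ≤ trPow K A := by
  rw [trPow_eq_sum_eigenvalues hA.isHermitian]
  exact Finset.sum_nonneg fun i _ => Real.rpow_nonneg (hA.eigenvalues_nonneg i) K

theorem trPow_smul {A : Matrix ι ι ℂ} (hA : A.PosSemidef) {c : ℝ} (hc : 0 ≤ c) :
    trPow K (c • A) = c ^ K * trPow K A := by
  rw [trPow, trPow, ← cfc_comp_const_mul c (fun x : ℝ => x ^ K) A
    ((A.finite_real_spectrum.image _).continuousOn _) hA.isHermitian.isSelfAdjoint]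
  rw [cfc_congr (g := fun x : ℝ => c ^ K * x ^ K), cfc_const_mul _ _ _ (continuousOn_spectrum _ _)]
  · simp
  · intro x hx
    obtain ⟨i, rfl⟩ := hA.isHermitian.spectrum_real_eq_range_eigenvalues ▸ hx
    exact Real.mul_rpow hc (hA.eigenvalues_nonneg i)

theorem trace_cfc_deriv_mul_self (hK : 1 < K) {A : Matrix ι ι ℂ} (hA : A.PosSemidef) :
    (cfc (fun x : ℝ => K * x ^ (K - 1)) A * A).trace.re = K * trPow K A := by
  have h := cfc_mul (fun x : ℝ => K * x ^ (K - 1)) (fun x => x) A (continuousOn_spectrum _ _)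
    (continuousOn_spectrum _ _)
  rw [cfc_id' ℝ A hA.isHermitian.isSelfAdjoint] at h
  rw [← h, trPow, cfc_congr (g := fun x : ℝ => K * x ^ K),
    cfc_const_mul _ _ _ (continuousOn_spectrum _ _)]
  · simp
  · intro x hx
    obtain ⟨i, rfl⟩ := hA.isHermitian.spectrum_real_eq_range_eigenvalues ▸ hx
    have := Real.rpow_add_of_nonneg (hA.eigenvalues_nonneg i) (by linarith : 0 ≤ K - 1) zero_le_one
    simp only [Real.rpow_one, sub_add_cancel] at this
    simp only [this, mul_assoc]

theorem rpow_perspective_ge (hK : 1 < K) {x y t : ℝ} (hx : 0 ≤ x) (hy : 0 ≤ y) (ht : 0 < t) :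
    K * x ^ (K - 1) * y - (K - 1) * t * x ^ K ≤ y ^ K / t ^ (K - 1) := by
  rcases hx.eq_or_lt with rfl | hx
  · rw [Real.zero_rpow (by linarith), Real.zero_rpow (by linarith)]
    simp only [mul_zero, zero_mul, sub_zero]
    positivity
  · have hz : 0 ≤ y / (t * x) := by positivity
    -- Bernoulli at the ratio `y / (t x)`; multiplying by `t x ^ K` homogenizes it.
    have h := one_add_mul_self_le_rpow_one_add (s := y / (t * x) - 1) (by linarith) hK.le
    rw [add_sub_cancel, Real.div_rpow hy (by positivity), Real.mul_rpow ht.le hx.le] at h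
    have e1 : t ^ K = t ^ (K - 1) * t := by rw [← Real.rpow_add_one ht.ne', sub_add_cancel]
    have e2 : x ^ K = x ^ (K - 1) * x := by rw [← Real.rpow_add_one hx.ne', sub_add_cancel]
    have p1 : 0 < t ^ (K - 1) := Real.rpow_pos_of_pos ht _
    have p2 : 0 < x ^ (K - 1) := Real.rpow_pos_of_pos hx _
    have h' := mul_le_mul_of_nonneg_left h (by positivity : 0 ≤ t * x ^ K)
    calc _ = t * x ^ K * (1 + K * (y / (t * x) - 1)) := by
          rw [e2]; field_simp; ring
      _ ≤ _ := h'
      _ = _ := by rw [e1]; field_simp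

/-- The perspective of Klein's inequality for `x ↦ x ^ K`. -/
theorem trPow_perspective_ge (hK : 1 < K) {A B : Matrix ι ι ℂ} (hA : A.PosSemidef)
    (hB : B.PosSemidef) {t : ℝ} (ht : 0 < t) :
    (cfc (fun x : ℝ => K * x ^ (K - 1)) A * B).trace.re - (K - 1) * t * trPow K A ≤
      trPow K B / t ^ (K - 1) := by
  obtain ⟨w, hw, H⟩ := exists_overlap hA.isHermitian hB.isHermitian
  have h1 := H (fun x : ℝ => K * x ^ (K - 1)) (fun x => x)
  have h2 := H (fun x : ℝ => x ^ K) (fun _ => 1)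
  have h3 := H (fun _ => 1) (fun x : ℝ => x ^ K)
  rw [cfc_id' ℝ B hB.isHermitian.isSelfAdjoint] at h1
  rw [cfc_const_one ℝ B hB.isHermitian.isSelfAdjoint, mul_one] at h2
  rw [cfc_const_one ℝ A hA.isHermitian.isSelfAdjoint, one_mul] at h3
  rw [h1, trPow, trPow, h2, h3, Finset.mul_sum, Finset.sum_div, ← Finset.sum_sub_distrib]
  refine Finset.sum_le_sum fun i _ => ?_
  rw [Finset.mul_sum, Finset.sum_div, ← Finset.sum_sub_distrib]
  refine Finset.sum_le_sum fun j _ => ?_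
  have := mul_le_mul_of_nonneg_left
    (rpow_perspective_ge hK (hA.eigenvalues_nonneg i) (hB.eigenvalues_nonneg j) ht) (hw i j)
  calc _ = w i j * (K * hA.isHermitian.eigenvalues i ^ (K - 1) * hB.isHermitian.eigenvalues j
        - (K - 1) * t * hA.isHermitian.eigenvalues i ^ K) := by ring
    _ ≤ _ := this
    _ = _ := by ring

/-- The degree one homogeneous extension of `trPow K` from the density matrices. -/
def homTrPow (K : ℝ) (A : Matrix ι ι ℂ) : ℝ := trPow K A / A.trace.re ^ (K - 1)

omit [DecidableEq ι] in
theorem trace_re_nonneg {A : Matrix ι ι ℂ} (hA : A.PosSemidef) : 0 ≤ A.trace.re :=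
  (Complex.le_def.1 hA.trace_nonneg).1

omit [DecidableEq ι] in
theorem eq_zero_of_trace_re_eq_zero {A : Matrix ι ι ℂ} (hA : A.PosSemidef)
    (h : A.trace.re = 0) : A = 0 :=
  hA.trace_eq_zero_iff.1 (Complex.ext h (Complex.le_def.1 hA.trace_nonneg).2.symm)

theorem homTrPow_nonneg {A : Matrix ι ι ℂ} (hA : A.PosSemidef) : 0 ≤ homTrPow K A :=
  div_nonneg (trPow_nonneg hA) (Real.rpow_nonneg (trace_re_nonneg hA) _)

theorem homTrPow_of_trace_eq_one {A : Matrix ι ι ℂ} (h : A.trace = 1) :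
    homTrPow K A = trPow K A := by simp [homTrPow, h]

/-- The left side is linear in `B`: for `A` of trace one it is the supporting functional of
`homTrPow K` at `A`. -/
theorem homTrPow_ge (hK : 1 < K) {A B : Matrix ι ι ℂ} (hA : A.PosSemidef) (hB : B.PosSemidef) :
    (cfc (fun x : ℝ => K * x ^ (K - 1)) A * B).trace.re - (K - 1) * B.trace.re * trPow K A ≤
      homTrPow K B := by
  rcases (trace_re_nonneg hB).eq_or_lt with h | h
  · rw [eq_zero_of_trace_re_eq_zero hB h.symm]
    simp only [mul_zero, Matrix.trace_zero, Complex.zero_re, zero_mul, sub_zero]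
    exact homTrPow_nonneg Matrix.PosSemidef.zero
  · exact trPow_perspective_ge hK hA hB h

theorem homTrPow_smul (hK : 1 < K) {A : Matrix ι ι ℂ} (hA : A.PosSemidef) {c : ℝ} (hc : 0 ≤ c) :
    homTrPow K (c • A) = c * homTrPow K A := by
  rcases hc.eq_or_lt with rfl | hc
  · simp [homTrPow, Real.zero_rpow (by linarith : K - 1 ≠ 0)]
  · rw [homTrPow, homTrPow, trPow_smul hA hc.le, Matrix.trace_smul, Complex.smul_re, smul_eq_mul,
      Real.mul_rpow hc.le (trace_re_nonneg hA), ← mul_div_assoc]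
    have e1 : c ^ K = c ^ (K - 1) * c := by rw [← Real.rpow_add_one hc.ne', sub_add_cancel]
    have p1 : 0 < c ^ (K - 1) := Real.rpow_pos_of_pos hc _
    rw [e1, mul_assoc, mul_div_mul_left _ _ p1.ne']

/-- Sum the supporting functionals at the normalized total `C = S / Tr S`: linearity collapses the
sum, and at `S = t • C` the functional equals `homTrPow K S`. -/
theorem homTrPow_sum_le (hK : 1 < K) {τ : Type*} [Fintype τ] {B : τ → Matrix ι ι ℂ}
    (hB : ∀ k, (B k).PosSemidef) : homTrPow K (∑ k, B k) ≤ ∑ k, homTrPow K (B k) := by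
  set S := ∑ k, B k with hS
  have hSp : S.PosSemidef := Matrix.posSemidef_sum _ fun k _ => hB k
  set t := S.trace.re with ht
  rcases (trace_re_nonneg hSp).eq_or_lt with h | h
  -- At trace zero the quotient is a division by 0, hence 0 by convention.
  · rw [homTrPow, ← h, Real.zero_rpow (by linarith), div_zero]
    exact Finset.sum_nonneg fun k _ => homTrPow_nonneg (hB k)
  · have hC : (t⁻¹ • S).PosSemidef := hSp.smul (inv_nonneg.2 h.le)
    have hSC : S = t • (t⁻¹ • S) := by rw [smul_smul, mul_inv_cancel₀ h.ne', one_smul]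
    have hCt : (t⁻¹ • S).trace.re = 1 := by
      rw [Matrix.trace_smul, Complex.smul_re, smul_eq_mul, inv_mul_cancel₀ h.ne']
    set C := t⁻¹ • S with hCdef
    have lhs : homTrPow K S = t * trPow K C := by
      rw [hSC, homTrPow_smul hK hC h.le, homTrPow, hCt, Real.one_rpow, div_one]
    have main := Finset.sum_le_sum fun k (_ : k ∈ Finset.univ) => homTrPow_ge hK hC (hB k)
    refine le_trans (le_of_eq ?_) main
    rw [Finset.sum_sub_distrib, ← Complex.re_sum, ← Matrix.trace_sum, ← Matrix.mul_sum,
      ← Finset.sum_mul, ← Finset.mul_sum, ← Complex.re_sum, ← Matrix.trace_sum, ← hS, lhs, ← ht]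
    have e : (cfc (fun x : ℝ => K * x ^ (K - 1)) C * S).trace.re = t * (K * trPow K C) := by
      rw [hSC, Matrix.mul_smul, Matrix.trace_smul, Complex.smul_re, smul_eq_mul,
        trace_cfc_deriv_mul_self hK hC]
    rw [e]
    ring

omit [DecidableEq ι] [DecidableEq κ] in
theorem trace_transpose_mul_conjTranspose (M : Matrix ι κ ℂ) :
    (Mᵀ * Mᵀᴴ).trace = (M * Mᴴ).trace := by
  have h : Mᵀ * Mᵀᴴ = (Mᴴ * M)ᵀ := by
    rw [Matrix.transpose_mul]; rfl
  rw [h, Matrix.trace_transpose, Matrix.trace_mul_comm]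

theorem homTrPow_transpose_mul_conjTranspose (hK : 1 < K) (M : Matrix ι κ ℂ) :
    homTrPow K (Mᵀ * Mᵀᴴ) = homTrPow K (M * Mᴴ) := by
  rw [homTrPow, homTrPow, trPow_transpose_mul_conjTranspose hK, trace_transpose_mul_conjTranspose]

theorem homTrPow_isometry (hK : 1 < K) {A : Matrix ι ι ℂ} (hA : A.IsHermitian) {V : Matrix κ ι ℂ}
    (hV : Vᴴ * V = 1) : homTrPow K (V * A * Vᴴ) = homTrPow K A := by
  rw [homTrPow, homTrPow, trPow_isometry hK hA hV, Matrix.trace_mul_comm, ← Matrix.mul_assoc, hV,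
    Matrix.one_mul]

/-- A measurement on one side of a bipartite pure state, followed by isometries on the other side,
does not decrease the average purity of the reduced states. -/
theorem homTrPow_le_sum_measure (hK : 1 < K) {τ : Type*} [Fintype τ] {ι' κ' : τ → Type*}
    [∀ k, Fintype (ι' k)] [∀ k, DecidableEq (ι' k)] [∀ k, Fintype (κ' k)]
    [∀ k, DecidableEq (κ' k)] (M : Matrix ι κ ℂ) (V : ∀ k, Matrix (ι' k) ι ℂ)
    (W : ∀ k, Matrix (κ' k) κ ℂ) (hV : ∀ k, (V k)ᴴ * V k = 1) (hW : ∑ k, (W k)ᴴ * W k = 1) :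
    homTrPow K (M * Mᴴ) ≤ ∑ k, homTrPow K ((V k * M * (W k)ᵀ) * (V k * M * (W k)ᵀ)ᴴ) := by
  have hB : ∀ k, ((M * (W k)ᵀ) * (M * (W k)ᵀ)ᴴ).PosSemidef := fun k =>
    Matrix.posSemidef_self_mul_conjTranspose _
  -- The measured side is traced out, so by completeness the branches add up to the original reduced
  -- state.
  have hsum : ∑ k, (M * (W k)ᵀ) * (M * (W k)ᵀ)ᴴ = M * Mᴴ := by
    have h : ∀ k, (M * (W k)ᵀ) * (M * (W k)ᵀ)ᴴ = M * ((W k)ᴴ * W k)ᵀ * Mᴴ := by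
      intro k
      rw [Matrix.conjTranspose_mul, Matrix.transpose_mul]
      simp only [Matrix.mul_assoc]
      rfl
    simp only [h]
    rw [← Matrix.sum_mul, ← Matrix.mul_sum, ← Matrix.transpose_sum, hW, Matrix.transpose_one,
      Matrix.mul_one]
  rw [← hsum]
  refine (homTrPow_sum_le hK hB).trans (le_of_eq (Finset.sum_congr rfl fun k _ => ?_))
  rw [← homTrPow_isometry hK (hB k).isHermitian (hV k)]
  congr 1
  simp only [Matrix.conjTranspose_mul, Matrix.mul_assoc]

/-- Transposing `M` exchanges the two sides of the cut without changing `homTrPow`. -/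
theorem homTrPow_le_sum_measure_left (hK : 1 < K) {τ : Type*} [Fintype τ] {ι' κ' : τ → Type*}
    [∀ k, Fintype (ι' k)] [∀ k, DecidableEq (ι' k)] [∀ k, Fintype (κ' k)]
    [∀ k, DecidableEq (κ' k)] (M : Matrix ι κ ℂ) (V : ∀ k, Matrix (ι' k) ι ℂ)
    (W : ∀ k, Matrix (κ' k) κ ℂ) (hV : ∑ k, (V k)ᴴ * V k = 1) (hW : ∀ k, (W k)ᴴ * W k = 1) :
    homTrPow K (M * Mᴴ) ≤ ∑ k, homTrPow K ((V k * M * (W k)ᵀ) * (V k * M * (W k)ᵀ)ᴴ) := by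
  have h := homTrPow_le_sum_measure hK Mᵀ W V hW hV
  rw [homTrPow_transpose_mul_conjTranspose hK] at h
  refine h.trans (le_of_eq (Finset.sum_congr rfl fun k _ => ?_))
  rw [← homTrPow_transpose_mul_conjTranspose hK (V k * M * (W k)ᵀ)]
  simp only [Matrix.transpose_mul, Matrix.transpose_transpose, Matrix.mul_assoc]

end TrPow

/-! ### Tensor products of local operators -/

section Tensor

variable {I : Type*} [Fintype I] {κ κ' κ'' : I → Type*}

/-- The tensor product of a family of matrices, in the product basis. -/
def tensorOp (A : ∀ i, Matrix (κ' i) (κ i) ℂ) : Matrix (∀ i, κ' i) (∀ i, κ i) ℂ :=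
  Matrix.of fun x y => ∏ i, A i (x i) (y i)

theorem tensorOp_conjTranspose (A : ∀ i, Matrix (κ' i) (κ i) ℂ) :
    (tensorOp A)ᴴ = tensorOp fun i => (A i)ᴴ := by
  ext x y
  simp [tensorOp, Matrix.conjTranspose_apply]

theorem tensorOp_mul [DecidableEq I] [∀ i, Fintype (κ' i)] (A : ∀ i, Matrix (κ'' i) (κ' i) ℂ)
    (B : ∀ i, Matrix (κ' i) (κ i) ℂ) :
    tensorOp A * tensorOp B = tensorOp fun i => A i * B i := by
  ext x y
  simp only [tensorOp, Matrix.mul_apply, Matrix.of_apply, ← Finset.prod_mul_distrib]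
  rw [Finset.prod_univ_sum, Fintype.piFinset_univ]

theorem tensorOp_one [∀ i, DecidableEq (κ i)] [DecidableEq (∀ i, κ i)] :
    tensorOp (fun i => (1 : Matrix (κ i) (κ i) ℂ)) = 1 := by
  ext x y
  rw [tensorOp, Matrix.of_apply, Matrix.one_apply]
  split_ifs with h
  · subst h; simp
  · obtain ⟨i, hi⟩ := Function.ne_iff.1 h
    exact Finset.prod_eq_zero (Finset.mem_univ i) (Matrix.one_apply_ne hi)

theorem sum_tensorOp_eq_one [DecidableEq I] [∀ i, DecidableEq (κ i)] [DecidableEq (∀ i, κ i)]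
    {τ : Type*} [Fintype τ] (j : I) (A : τ → ∀ i, Matrix (κ i) (κ i) ℂ) (hj : ∑ k, A k j = 1)
    (h : ∀ k i, i ≠ j → A k i = 1) : ∑ k, tensorOp (A k) = 1 := by
  rw [← tensorOp_one]
  ext x y
  simp only [Matrix.sum_apply, tensorOp, Matrix.of_apply]
  have e : ∀ k, ∏ i, A k i (x i) (y i) = A k j (x j) (y j) *
      ∏ i ∈ Finset.univ.erase j, (1 : Matrix (κ i) (κ i) ℂ) (x i) (y i) := fun k => by
    rw [← Finset.mul_prod_erase _ _ (Finset.mem_univ j)]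
    congr 1
    exact Finset.prod_congr rfl fun i hi => by rw [h k i (Finset.ne_of_mem_erase hi)]
  rw [Finset.sum_congr rfl fun k _ => e k, ← Finset.sum_mul, ← Matrix.sum_apply, hj]
  exact Finset.mul_prod_erase Finset.univ (fun i => (1 : Matrix (κ i) (κ i) ℂ) (x i) (y i))
    (Finset.mem_univ j)

end Tensor

/-! ### Reduced states and coefficient matrices -/

section Reduced

variable {n : ℕ} {d d' : Fin n → ℕ}

/-- Labels of the whole system as pairs of labels on `α` and off `α`. -/
def glueEquiv (d : Fin n → ℕ) (α : Finset (Fin n)) :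
    (∀ i : {i // i ∈ α}, Fin (d i)) × (∀ i : {i // i ∉ α}, Fin (d i)) ≃ ∀ i, Fin (d i) :=
  (Equiv.piEquivPiSubtypeProd (· ∈ α) fun i => Fin (d i)).symm

theorem sum_glue {M : Type*} [AddCommMonoid M] (α : Finset (Fin n)) (f : (∀ i, Fin (d i)) → M) :
    ∑ x, f x = ∑ a, ∑ e, f (glue α a e) := by
  rw [← (glueEquiv d α).sum_comp, Fintype.sum_prod_type]
  rfl

theorem prod_glue {M : Type*} [CommMonoid M] (α : Finset (Fin n))
    (f : ∀ i, Fin (d i) → M) (a : ∀ i : {i // i ∈ α}, Fin (d i))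
    (e : ∀ i : {i // i ∉ α}, Fin (d i)) :
    ∏ i, f i (glue α a e i) = (∏ i : {i // i ∈ α}, f i (a i)) * ∏ i : {i // i ∉ α}, f i (e i) := by
  rw [← Fintype.prod_subtype_mul_prod_subtype (· ∈ α)]
  congr 1
  · exact Finset.prod_congr (by ext; simp) fun i _ => by simp [glue, i.2]
  · exact Finset.prod_congr (by ext; simp) fun i _ => by simp [glue, i.2]

theorem reduced_sub (ρ σ : Op d) (α : Finset (Fin n)) :
    reduced (ρ - σ) α = reduced ρ α - reduced σ α := by
  ext a b
  simp [reduced, Finset.sum_sub_distrib]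

theorem reduced_smul (c : ℂ) (ρ : Op d) (α : Finset (Fin n)) :
    reduced (c • ρ) α = c • reduced ρ α := by
  ext a b
  simp [reduced, Finset.mul_sum]

theorem trace_reduced (ρ : Op d) (α : Finset (Fin n)) : (reduced ρ α).trace = ρ.trace :=
  (sum_glue α fun x => ρ x x).symm

theorem posSemidef_reduced {ρ : Op d} (hρ : ρ.PosSemidef) (α : Finset (Fin n)) :
    (reduced ρ α).PosSemidef := by
  have h : reduced ρ α = ∑ e, ρ.submatrix (fun a => glue α a e) (fun a => glue α a e) := by
    ext a b
    simp [reduced, Matrix.sum_apply]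
  rw [h]
  exact Matrix.posSemidef_sum _ fun e _ => hρ.submatrix _

theorem proj_eq_vecMulVec (ψ : Ket d) : proj ψ = Matrix.vecMulVec ψ.ofLp (star ψ.ofLp) := rfl

theorem posSemidef_proj (ψ : Ket d) : (proj ψ).PosSemidef := by
  rw [proj_eq_vecMulVec]
  exact Matrix.posSemidef_vecMulVec_self_star _

theorem star_dotProduct_self {ψ : Ket d} (h : ‖ψ‖ = 1) : star ψ.ofLp ⬝ᵥ ψ.ofLp = 1 := by
  have := EuclideanSpace.inner_eq_star_dotProduct ψ ψ
  rw [inner_self_eq_norm_sq_to_K, h] at this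
  rw [dotProduct_comm]
  simpa using this.symm

theorem trace_proj {ψ : Ket d} (h : ‖ψ‖ = 1) : (proj ψ).trace = 1 := by
  rw [proj_eq_vecMulVec, Matrix.trace_vecMulVec, dotProduct_comm, star_dotProduct_self h]

theorem trace_reduced_proj {ψ : Ket d} (h : ‖ψ‖ = 1) (α : Finset (Fin n)) :
    (reduced (proj ψ) α).trace = 1 := by rw [trace_reduced, trace_proj h]

/-- The coefficients of a ket as a matrix for the bipartition into `α` and its complement. -/
def coeffMatrix (ψ : Ket d) (α : Finset (Fin n)) :
    Matrix (∀ i : {i // i ∈ α}, Fin (d i)) (∀ i : {i // i ∉ α}, Fin (d i)) ℂ :=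
  Matrix.of fun a e => ψ (glue α a e)

theorem reduced_proj (ψ : Ket d) (α : Finset (Fin n)) :
    reduced (proj ψ) α = coeffMatrix ψ α * (coeffMatrix ψ α)ᴴ := by
  ext a b
  simp [reduced, proj, coeffMatrix, Matrix.mul_apply]

/-- The image of a ket under an operator. -/
def applyOp (A : Matrix (∀ i, Fin (d' i)) (∀ i, Fin (d i)) ℂ) (ψ : Ket d) : Ket d' :=
  WithLp.toLp 2 (A *ᵥ ψ.ofLp)

theorem proj_applyOp (A : Matrix (∀ i, Fin (d' i)) (∀ i, Fin (d i)) ℂ) (ψ : Ket d) :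
    proj (applyOp A ψ) = A * proj ψ * Aᴴ := by
  rw [proj_eq_vecMulVec, proj_eq_vecMulVec, Matrix.mul_vecMulVec, Matrix.vecMulVec_mul,
    applyOp, Matrix.star_mulVec]

/-- Puts a local step in the form `V * M * Wᵀ` of the bipartite measurement inequalities. -/
theorem coeffMatrix_applyOp (A : ∀ i, Matrix (Fin (d' i)) (Fin (d i)) ℂ) (ψ : Ket d)
    (α : Finset (Fin n)) :
    coeffMatrix (applyOp (productOp A) ψ) α =
      tensorOp (fun i : {i // i ∈ α} => A i) * coeffMatrix ψ α *
        (tensorOp fun i : {i // i ∉ α} => A i)ᵀ := by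
  ext a e
  simp only [coeffMatrix, applyOp, Matrix.of_apply, Matrix.mulVec, dotProduct, Matrix.mul_apply,
    Matrix.transpose_apply, Finset.sum_mul]
  rw [sum_glue α, Finset.sum_comm]
  refine Finset.sum_congr rfl fun e' _ => Finset.sum_congr rfl fun a' _ => ?_
  have : productOp A (glue α a e) (glue α a' e') =
      (∏ i : {i // i ∈ α}, A i (a i) (a' i)) * ∏ i : {i // i ∉ α}, A i (e i) (e' i) := by
    rw [productOp, Matrix.of_apply, prod_glue α fun i x => A i x (glue α a' e' i)]
    congr 1 <;> exact Finset.prod_congr rfl fun i _ => by simp [glue, i.2]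
  rw [this]
  simp only [tensorOp, Matrix.of_apply]
  ring

end Reduced

/-! ### One round of a protocol -/

section Measurement

variable {n : ℕ} {d : Fin n → ℕ} {K : ℝ}

theorem tensorOp_isometry {I : Type*} [Fintype I] [DecidableEq I] {κ κ' : I → Type*}
    [∀ i, Fintype (κ' i)] [∀ i, DecidableEq (κ i)] [DecidableEq (∀ i, κ i)]
    (A : ∀ i, Matrix (κ' i) (κ i) ℂ) (h : ∀ i, (A i)ᴴ * A i = 1) :
    (tensorOp A)ᴴ * tensorOp A = 1 := by
  rw [tensorOp_conjTranspose, tensorOp_mul]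
  simp only [h]
  exact tensorOp_one

theorem tensorOp_measurement {I : Type*} [Fintype I] [DecidableEq I] {τ : Type*} [Fintype τ]
    {κ : I → Type*} {κ' : τ → I → Type*} [∀ k i, Fintype (κ' k i)] [∀ i, DecidableEq (κ i)]
    [DecidableEq (∀ i, κ i)] (j : I) (A : ∀ k i, Matrix (κ' k i) (κ i) ℂ)
    (hj : ∑ k, (A k j)ᴴ * A k j = 1) (h : ∀ k i, i ≠ j → (A k i)ᴴ * A k i = 1) :
    ∑ k, (tensorOp (A k))ᴴ * tensorOp (A k) = 1 := by
  simp only [tensorOp_conjTranspose, tensorOp_mul]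
  exact sum_tensorOp_eq_one j _ hj h

/-- A local measurement followed by local isometries does not decrease the average purity of the
reduced states of a pure state. -/
theorem homTrPow_reduced_le_sum (hK : 1 < K) (α : Finset (Fin n)) (j : Fin n) {m : ℕ}
    (d' : Fin m → Fin n → ℕ) (A : ∀ (k : Fin m) (i : Fin n), Matrix (Fin (d' k i)) (Fin (d i)) ℂ)
    (measurement : ∑ k, (A k j)ᴴ * A k j = 1)
    (isometry : ∀ k i, i ≠ j → (A k i)ᴴ * A k i = 1) (ψ : Ket d) :
    homTrPow K (reduced (proj ψ) α) ≤
      ∑ k, homTrPow K (reduced (proj (applyOp (productOp (A k)) ψ)) α) := by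
  simp only [reduced_proj, coeffMatrix_applyOp]
  by_cases hj : j ∈ α
  · refine homTrPow_le_sum_measure_left hK _ _ _ ?_ fun k => tensorOp_isometry _ fun i =>
      isometry k i fun h => i.2 (h ▸ hj)
    exact tensorOp_measurement (⟨j, hj⟩ : {i // i ∈ α}) (fun k (i : {i // i ∈ α}) => A k i)
      measurement fun k i hi => isometry k i fun h => hi (Subtype.ext h)
  · refine homTrPow_le_sum_measure hK _ _ _ (fun k => tensorOp_isometry _ fun i =>
      isometry k i fun h => hj (h ▸ i.2)) ?_
    exact tensorOp_measurement (⟨j, hj⟩ : {i // i ∉ α}) (fun k (i : {i // i ∉ α}) => A k i)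
      measurement fun k i hi => isometry k i fun h => hi (Subtype.ext h)

end Measurement

/-! ### Induction over LOCC protocols -/

section Protocol

variable {n : ℕ} {d dout : Fin n → ℕ} {ι : Type*} [DecidableEq ι] {K : ℝ}

theorem LOCC.posSemidef_output (P : LOCC ι dout d) {ρ : Op d} (hρ : ρ.PosSemidef) (l : ι) :
    (P.output ρ l).PosSemidef := by
  induction P with
  | done label =>
    rw [LOCC.output]
    split_ifs
    exacts [hρ, Matrix.PosSemidef.zero]
  | step j d' A measurement isometry next ih =>
    rw [LOCC.output]
    exact Matrix.posSemidef_sum _ fun k _ => ih k (hρ.mul_mul_conjTranspose_same _)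

theorem LOCC.sum_trace_output [Fintype ι] (P : LOCC ι dout d) (ρ : Op d) :
    ∑ l, (P.output ρ l).trace = ρ.trace := by
  induction P with
  | done label =>
    simp only [LOCC.output]
    rw [Finset.sum_eq_single label] <;> simp +contextual
  | step j d' A measurement isometry next ih =>
    simp only [LOCC.output, Matrix.trace_sum]
    rw [Finset.sum_comm]
    simp only [ih]
    have h : ∀ k, (productOp (A k) * ρ * (productOp (A k))ᴴ).trace =
        ((productOp (A k))ᴴ * productOp (A k) * ρ).trace := fun k => by
      rw [Matrix.trace_mul_comm, Matrix.mul_assoc]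
    simp only [h]
    rw [← Matrix.trace_sum, ← Matrix.sum_mul]
    have := tensorOp_measurement j A measurement isometry
    change ∑ k, (productOp (A k))ᴴ * productOp (A k) = 1 at this
    rw [this, Matrix.one_mul]

/-- Positive semidefinite matrices that sum to a multiple of a pure state are multiples of it. -/
theorem eq_smul_proj_of_sum_eq {τ : Type*} [Fintype τ] {B : τ → Op d}
    (hB : ∀ k, (B k).PosSemidef) {p : ℝ} {φ : Ket d} (hφ : ‖φ‖ = 1)
    (h : ∑ k, B k = (p : ℂ) • proj φ) (k : τ) :
    B k = (((B k).trace.re : ℝ) : ℂ) • proj φ := by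
  have hid : proj φ * proj φ = proj φ := by
    rw [proj_eq_vecMulVec, Matrix.vecMulVec_mul_vecMulVec, star_dotProduct_self hφ, one_smul]
  have hH : (proj φ)ᴴ = proj φ := (posSemidef_proj φ).isHermitian
  -- Compression by `Q` kills the sum, hence each of its positive semidefinite terms.
  set Q : Op d := 1 - proj φ with hQ
  have hQH : Qᴴ = Q := by rw [hQ, Matrix.conjTranspose_sub, hH, Matrix.conjTranspose_one]
  have hPQ : proj φ * Q = 0 := by rw [hQ, Matrix.mul_sub, hid, Matrix.mul_one, sub_self]
  have hps : ∀ k, (Q * B k * Q).PosSemidef := fun k => by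
    have := (hB k).mul_mul_conjTranspose_same Q
    rwa [hQH] at this
  have hsum : ∑ k, (Q * B k * Q).trace.re = 0 := by
    rw [← Complex.re_sum, ← Matrix.trace_sum, ← Matrix.sum_mul, ← Matrix.mul_sum, h,
      Matrix.mul_smul, Matrix.smul_mul, Matrix.mul_assoc, hPQ]
    simp
  have hz : Q * B k * Q = 0 := eq_zero_of_trace_re_eq_zero (hps k)
    ((Finset.sum_eq_zero_iff_of_nonneg fun k _ => trace_re_nonneg (hps k)).1 hsum k
      (Finset.mem_univ k))
  -- The factorization turns `Q B Q = (CQ)ᴴ (CQ) = 0` into `C Q = 0`, hence `B Q = 0`.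
  obtain ⟨C, hC⟩ : ∃ C : Op d, B k = Cᴴ * C := by
    open scoped MatrixOrder in
    exact CStarAlgebra.nonneg_iff_eq_star_mul_self.1 (hB k).nonneg
  have hCQ : C * Q = 0 := by
    rw [← Matrix.conjTranspose_mul_self_eq_zero, Matrix.conjTranspose_mul, hQH, ← hz, hC]
    simp only [Matrix.mul_assoc]
  have hBP : B k * proj φ = B k := by
    have : B k * Q = 0 := by rw [hC, Matrix.mul_assoc, hCQ, Matrix.mul_zero]
    rw [hQ, Matrix.mul_sub, Matrix.mul_one, sub_eq_zero] at this
    exact this.symm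
  have hPB : proj φ * B k = B k := by
    have := congrArg Matrix.conjTranspose hBP
    rwa [Matrix.conjTranspose_mul, hH, (hB k).isHermitian.eq] at this
  have hc : B k = (star φ.ofLp ⬝ᵥ B k *ᵥ φ.ofLp) • proj φ := by
    conv_lhs => rw [← hPB, ← hBP]
    rw [proj_eq_vecMulVec, Matrix.mul_vecMulVec, Matrix.vecMulVec_mul_vecMulVec]
    ext; simp [Matrix.vecMulVec_apply]; ring
  have htr : (B k).trace = star φ.ofLp ⬝ᵥ B k *ᵥ φ.ofLp := by
    conv_lhs => rw [hc]
    rw [Matrix.trace_smul, trace_proj hφ, smul_eq_mul, mul_one]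
  have him : (((B k).trace.re : ℝ) : ℂ) = (B k).trace :=
    Complex.ext rfl (Complex.le_def.1 (hB k).trace_nonneg).2
  rw [him, htr]
  exact hc

theorem homTrPow_reduced_smul_proj (hK : 1 < K) {φ : Ket d} (hφ : ‖φ‖ = 1) {p : ℝ} (hp : 0 ≤ p)
    (α : Finset (Fin n)) :
    homTrPow K (reduced ((p : ℂ) • proj φ) α) = p * trPow K (reduced (proj φ) α) := by
  rw [reduced_smul, Complex.coe_smul, homTrPow_smul hK (posSemidef_reduced (posSemidef_proj φ) α) hp,
    homTrPow_of_trace_eq_one (trace_reduced_proj hφ α)]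

/-- Neither `ψ` nor the weights `p` are normalized, because the induction meets unnormalized
branches; homogeneity of `homTrPow` absorbs their probabilities. -/
theorem LOCC.homTrPow_reduced_le [Fintype ι] (hK : 1 < K) (α : Finset (Fin n))
    (P : LOCC ι dout d) (ψ : Ket d) (p : ι → ℝ) (φ : ι → Ket dout) (hp : ∀ l, 0 ≤ p l)
    (hφ : ∀ l, ‖φ l‖ = 1) (h : ∀ l, P.output (proj ψ) l = (p l : ℂ) • proj (φ l)) :
    homTrPow K (reduced (proj ψ) α) ≤ ∑ l, p l * trPow K (reduced (proj (φ l)) α) := by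
  induction P generalizing p with
  | done label =>
    have hl := h label
    rw [LOCC.output, if_pos rfl] at hl
    rw [hl, homTrPow_reduced_smul_proj hK (hφ label) (hp label)]
    exact Finset.single_le_sum (f := fun l => p l * trPow K (reduced (proj (φ l)) α))
      (fun l _ => mul_nonneg (hp l) (trPow_nonneg (posSemidef_reduced (posSemidef_proj _) α)))
      (Finset.mem_univ label)
  | step j d' A measurement isometry next ih =>
    simp only [LOCC.output, ← proj_applyOp] at h
    have hps : ∀ l k, ((next k).output (proj (applyOp (productOp (A k)) ψ)) l).PosSemidef :=
      fun l k => (next k).posSemidef_output (posSemidef_proj _) l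
    refine (homTrPow_reduced_le_sum hK α j d' A measurement isometry ψ).trans ?_
    -- In branch `k` the weight of label `l` is the trace of that branch's output; over `k` these
    -- add up to `p l`.
    refine (Finset.sum_le_sum fun k _ => ih k (applyOp (productOp (A k)) ψ)
      (fun l => ((next k).output (proj (applyOp (productOp (A k)) ψ)) l).trace.re)
      (fun l => trace_re_nonneg (hps l k))
      (fun l => eq_smul_proj_of_sum_eq (hps l) (hφ l) (h l) k)).trans (le_of_eq ?_)
    rw [Finset.sum_comm]
    refine Finset.sum_congr rfl fun l _ => ?_
    rw [← Finset.sum_mul, ← Complex.re_sum, ← Matrix.trace_sum, h l, Matrix.trace_smul,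
      trace_proj (hφ l)]
    simp

theorem LOCC.sum_prob_eq_one [Fintype ι] (P : LOCC ι dout d) {ψ : Ket d} (hψ : ‖ψ‖ = 1)
    {p : ι → ℝ} {φ : ι → Ket dout} (hφ : ∀ l, ‖φ l‖ = 1)
    (h : ∀ l, P.output (proj ψ) l = (p l : ℂ) • proj (φ l)) : ∑ l, p l = 1 := by
  have := P.sum_trace_output (proj ψ)
  simp only [h, Matrix.trace_smul, trace_proj hψ, trace_proj (hφ _), smul_eq_mul, mul_one] at this
  exact_mod_cast this

end Protocol

section GCEProperties

variable {n : ℕ} {d : Fin n → ℕ} {K : ℝ}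

/-! ### Product states -/

section Product

/-- In the other order the product is a `1 × 1` matrix, and its entry is the trace. -/
theorem trPow_mul_eq_one {ι : Type*} [Fintype ι] [DecidableEq ι] (hK : 1 < K)
    (X : Matrix ι Unit ℂ) (Y : Matrix Unit ι ℂ) (h : (X * Y).IsHermitian)
    (ht : (X * Y).trace = 1) : trPow K (X * Y) = 1 := by
  have h1 : Y * X = 1 := by
    rw [Matrix.trace_mul_comm] at ht
    ext i j
    simpa [Matrix.trace] using ht
  rw [trPow_mul_comm hK X Y h (by rw [h1]; exact Matrix.isHermitian_one), h1, trPow,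
    cfc_apply_one]
  simp

theorem norm_productKet {φ : ∀ j, EuclideanSpace ℂ (Fin (d j))} (h : ∀ j, ‖φ j‖ = 1) :
    ‖productKet φ‖ = 1 := by
  have hj : ∀ j, ∑ x, ‖φ j x‖ ^ 2 = 1 := fun j => by
    rw [← EuclideanSpace.norm_sq_eq, h j, one_pow]
  have : ‖productKet φ‖ ^ 2 = 1 := by
    rw [EuclideanSpace.norm_sq_eq]
    simp only [productKet, norm_prod, ← Finset.prod_pow]
    have e := Finset.prod_univ_sum (fun j => (Finset.univ : Finset (Fin (d j))))
      fun j x => ‖φ j x‖ ^ 2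
    rw [Fintype.piFinset_univ] at e
    rw [← e, Finset.prod_congr rfl fun j _ => hj j, Finset.prod_const_one]
  exact (pow_eq_one_iff_of_nonneg (norm_nonneg _) two_ne_zero).1 this

theorem trPow_reduced_productKet (hK : 1 < K) {φ : ∀ j, EuclideanSpace ℂ (Fin (d j))}
    (h : ∀ j, ‖φ j‖ = 1) (α : Finset (Fin n)) :
    trPow K (reduced (proj (productKet φ)) α) = 1 := by
  set X : Matrix (∀ i : {i // i ∈ α}, Fin (d i)) Unit ℂ :=
    Matrix.replicateCol Unit fun a => ∏ i : {i // i ∈ α}, φ i (a i) with hX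
  set Y : Matrix Unit (∀ i : {i // i ∉ α}, Fin (d i)) ℂ :=
    Matrix.replicateRow Unit fun e => ∏ i : {i // i ∉ α}, φ i (e i) with hY
  have hM : coeffMatrix (productKet φ) α = X * Y := by
    ext a e
    simp only [coeffMatrix, productKet, Matrix.of_apply]
    rw [prod_glue α fun i x => φ i x]
    simp [hX, hY, Matrix.mul_apply]
  have ht := trace_reduced_proj (norm_productKet h) α
  have hH := (posSemidef_reduced (posSemidef_proj (productKet φ)) α).isHermitian
  rw [reduced_proj, hM, Matrix.mul_assoc] at ht hH ⊢
  exact trPow_mul_eq_one hK _ _ hH ht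

end Product

/-! ### Complementary sets of parties -/

section Complement

theorem trPow_submatrix_equiv {ι κ : Type*} [Fintype ι] [DecidableEq ι] [Fintype κ]
    [DecidableEq κ] (hK : 1 < K) {A : Matrix ι ι ℂ} (hA : A.IsHermitian) (e : κ ≃ ι) :
    trPow K (A.submatrix e e) = trPow K A := by
  have h1 : A.submatrix e id * (1 : Matrix ι ι ℂ).submatrix id e = A.submatrix e e := by
    ext i j
    simp [Matrix.mul_apply, Matrix.one_apply]
  have h2 : (1 : Matrix ι ι ℂ).submatrix id e * A.submatrix e id = A := by
    rw [Matrix.submatrix_mul_equiv, Matrix.one_mul, Matrix.submatrix_id_id]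
  rw [← h1, trPow_mul_comm hK _ _ (by rw [h1]; exact hA.submatrix e) (by rwa [h2]), h2]

/-- The reduced states of a pure state on complementary sets of parties have the same spectrum up
to zeros. -/
theorem trPow_reduced_compl (hK : 1 < K) (ψ : Ket d) (α : Finset (Fin n)) :
    trPow K (reduced (proj ψ) αᶜ) = trPow K (reduced (proj ψ) α) := by
  let e₁ : (∀ i : {i // i ∈ αᶜ}, Fin (d i)) ≃ ∀ i : {i // i ∉ α}, Fin (d i) :=
    { toFun := fun a i => a ⟨i, Finset.mem_compl.2 i.2⟩
      invFun := fun a i => a ⟨i, Finset.mem_compl.1 i.2⟩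
      left_inv := fun _ => rfl
      right_inv := fun _ => rfl }
  let e₂ : (∀ i : {i // i ∉ αᶜ}, Fin (d i)) ≃ ∀ i : {i // i ∈ α}, Fin (d i) :=
    { toFun := fun a i => a ⟨i, fun h => Finset.mem_compl.1 h i.2⟩
      invFun := fun a i => a ⟨i, by simpa using i.2⟩
      left_inv := fun _ => rfl
      right_inv := fun _ => rfl }
  have hg : ∀ a b, glue αᶜ a b = glue α (e₂ b) (e₁ a) := by
    intro a b
    funext i
    by_cases h : i ∈ α <;> simp [glue, h, e₁, e₂]
  have hM : coeffMatrix ψ αᶜ = (coeffMatrix ψ α)ᵀ.submatrix e₁ e₂ := by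
    ext a b
    simp [coeffMatrix, hg]
  rw [reduced_proj, reduced_proj, hM, Matrix.conjTranspose_submatrix, Matrix.submatrix_mul_equiv,
    trPow_submatrix_equiv hK (Matrix.isHermitian_mul_conjTranspose_self _),
    trPow_transpose_mul_conjTranspose hK]

theorem gce_univ_eq_gce_sdiff_singleton (hK : 1 < K) (ψ : Ket d) (j : Fin n) :
    gce K ψ Finset.univ = gce K ψ (Finset.univ \ {j}) := by
  set T := fun α => trPow K (reduced (proj ψ) α) with hT
  have hj : j ∉ Finset.univ \ {j} := by simp
  have hins : insert j (Finset.univ \ {j}) = Finset.univ := by ext; simp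
  have hsum : ∑ α ∈ (Finset.univ : Finset (Fin n)).powerset, T α =
      2 * ∑ α ∈ (Finset.univ \ {j}).powerset, T α := by
    rw [two_mul]
    conv_lhs => rw [← hins, Finset.sum_powerset_insert hj]
    congr 1
    -- Complementation carries the sets containing `j` to those avoiding it, and keeps the purity.
    refine Finset.sum_nbij' (fun α => (insert j α)ᶜ) (fun α => (insert j α)ᶜ) ?_ ?_ ?_ ?_ ?_
    · intro α _
      simp +contextual [Finset.subset_iff]
    · intro α _
      simp +contextual [Finset.subset_iff]
    · intro α hα
      have : j ∉ α := fun h => hj (Finset.mem_powerset.1 hα h)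
      ext i
      by_cases h : i = j <;> simp [h, this]
    · intro α hα
      have : j ∉ α := fun h => hj (Finset.mem_powerset.1 hα h)
      ext i
      by_cases h : i = j <;> simp [h, this]
    · intro α _
      exact (trPow_reduced_compl hK ψ _).symm
  have hcard : (Finset.univ : Finset (Fin n)).card = (Finset.univ \ {j}).card + 1 := by
    rw [← Finset.card_insert_of_notMem hj, hins]
  have : ∑ α ∈ (Finset.univ : Finset (Fin n)).powerset, trPow K (reduced (proj ψ) α) =
      2 * ∑ α ∈ (Finset.univ \ {j}).powerset, trPow K (reduced (proj ψ) α) := hsum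
  rw [gce, gce, this, hcard, pow_succ]
  field_simp

end Complement

/-! ### Continuity in the trace distance -/

section Continuity

/-- By Klein's inequality the difference is at most `Tr f(R) (R - S)` with `f(x) = K x ^ (K - 1)`.
Since `0 ≤ f(R) ≤ K`, only the positive part of `proj ψ - proj ψ'` contributes, and partial trace
preserves its trace. -/
theorem trPow_reduced_sub_le (hK : 1 < K) {ψ ψ' : Ket d} (hψ : ‖ψ‖ = 1) (hψ' : ‖ψ'‖ = 1)
    (α : Finset (Fin n)) :
    trPow K (reduced (proj ψ) α) - trPow K (reduced (proj ψ') α) ≤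
      K * traceNorm (proj ψ - proj ψ') := by
  set R := reduced (proj ψ) α with hR
  set S := reduced (proj ψ') α with hS
  have hRp : R.PosSemidef := posSemidef_reduced (posSemidef_proj ψ) α
  have hSp : S.PosSemidef := posSemidef_reduced (posSemidef_proj ψ') α
  have hRt : R.trace = 1 := trace_reduced_proj hψ α
  have hSt : S.trace = 1 := trace_reduced_proj hψ' α
  obtain ⟨P, N, hP, hN, hPN, hPt⟩ := exists_posSemidef_sub
    ((posSemidef_proj ψ).isHermitian.sub (posSemidef_proj ψ').isHermitian)
  have hRS : R - S = reduced P α - reduced N α := by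
    rw [← reduced_sub, ← reduced_sub, hPN]
  set f : ℝ → ℝ := fun x => K * x ^ (K - 1) with hf
  have h1 : (cfc f R * S).trace.re - (K - 1) * 1 * trPow K R ≤ trPow K S := by
    have := homTrPow_ge hK hRp hSp
    rwa [hSt, Complex.one_re, homTrPow_of_trace_eq_one hSt] at this
  have h2 : (cfc f R * R).trace.re = K * trPow K R := trace_cfc_deriv_mul_self hK hRp
  have h3 : (cfc f R * R).trace.re - (cfc f R * S).trace.re =
      (cfc f R * reduced P α).trace.re - (cfc f R * reduced N α).trace.re := by
    rw [← Complex.sub_re, ← Complex.sub_re, ← Matrix.trace_sub, ← Matrix.trace_sub,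
      ← Matrix.mul_sub, ← Matrix.mul_sub, hRS]
  have hev0 : ∀ i, 0 ≤ hRp.isHermitian.eigenvalues i := hRp.eigenvalues_nonneg
  -- Nonnegative eigenvalues with sum 1 are at most 1.
  have hev1 : ∀ i, hRp.isHermitian.eigenvalues i ≤ 1 := fun i => by
    have h := trace_cfc_re hRp.isHermitian fun x => x
    rw [cfc_id' ℝ R hRp.isHermitian.isSelfAdjoint, hRt, Complex.one_re] at h
    rw [h]
    exact Finset.single_le_sum (f := hRp.isHermitian.eigenvalues) (fun i _ => hev0 i)
      (Finset.mem_univ i)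
  have h4 : (cfc f R * reduced P α).trace.re ≤ K * P.trace.re := by
    have := trace_cfc_mul_le hRp.isHermitian (posSemidef_reduced hP α) (f := f) (g := fun _ => K)
      fun i => mul_le_of_le_one_right (by linarith)
        (Real.rpow_le_one (hev0 i) (hev1 i) (by linarith))
    rwa [cfc_const K R hRp.isHermitian.isSelfAdjoint, Algebra.algebraMap_eq_smul_one,
      smul_mul_assoc, one_mul, Matrix.trace_smul, Complex.smul_re, smul_eq_mul,
      trace_reduced] at this
  have h5 : 0 ≤ (cfc f R * reduced N α).trace.re := by
    have := trace_cfc_mul_le hRp.isHermitian (posSemidef_reduced hN α) (f := fun _ => 0) (g := f)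
      fun i => mul_nonneg (by linarith) (Real.rpow_nonneg (hev0 i) _)
    rwa [cfc_const_zero, zero_mul, Matrix.trace_zero, Complex.zero_re] at this
  have h6 : K * P.trace.re ≤ K * traceNorm (proj ψ - proj ψ') :=
    mul_le_mul_of_nonneg_left hPt (by linarith)
  linarith

theorem gce_sub_le (hK : 1 < K) {ψ ψ' : Ket d} (hψ : ‖ψ‖ = 1) (hψ' : ‖ψ'‖ = 1)
    (s : Finset (Fin n)) :
    gce K ψ s - gce K ψ' s ≤ 2 * K / (K - 1) * traceDist ψ' ψ := by
  have hK1 : 0 < K - 1 := by linarith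
  have hsum := Finset.sum_le_sum fun α (_ : α ∈ s.powerset) => trPow_reduced_sub_le hK hψ' hψ α
  rw [Finset.sum_sub_distrib, Finset.sum_const, Finset.card_powerset, nsmul_eq_mul] at hsum
  push_cast at hsum
  have e : gce K ψ s - gce K ψ' s = 1 / ((K - 1) * 2 ^ s.card) *
      (∑ α ∈ s.powerset, trPow K (reduced (proj ψ') α) -
        ∑ α ∈ s.powerset, trPow K (reduced (proj ψ) α)) := by
    rw [gce, gce]
    field_simp
    ring
  rw [e]
  refine (mul_le_mul_of_nonneg_left hsum (by positivity)).trans (le_of_eq ?_)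
  rw [traceDist]
  field_simp

theorem traceDist_comm (ψ ψ' : Ket d) : traceDist ψ ψ' = traceDist ψ' ψ := by
  rw [traceDist, traceDist, traceNorm, traceNorm, ← neg_sub (proj ψ') (proj ψ),
    Matrix.conjTranspose_neg, neg_mul_neg]

end Continuity

/-! ### From purities to the entanglement measure -/

theorem gce_productKet (hK : 1 < K) {φ : ∀ j, EuclideanSpace ℂ (Fin (d j))}
    (h : ∀ j, ‖φ j‖ = 1) (s : Finset (Fin n)) : gce K (productKet φ) s = 0 := by
  rw [gce, Finset.sum_congr rfl fun α _ => trPow_reduced_productKet hK h α]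
  simp

theorem LOCC.sum_gce_le {dout : Fin n → ℕ} {ι : Type*} [Fintype ι] [DecidableEq ι] (hK : 1 < K)
    (s : Finset (Fin n)) (P : LOCC ι dout d) {ψ : Ket d} {p : ι → ℝ} {φ : ι → Ket dout}
    (hψ : ‖ψ‖ = 1) (hp : ∀ l, 0 ≤ p l) (hφ : ∀ l, ‖φ l‖ = 1)
    (h : ∀ l, P.output (proj ψ) l = (p l : ℂ) • proj (φ l)) :
    ∑ l, p l * gce K (φ l) s ≤ gce K ψ s := by
  have hK1 : 0 < K - 1 := by linarith
  have hsum : ∑ α ∈ s.powerset, trPow K (reduced (proj ψ) α) ≤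
      ∑ l, p l * ∑ α ∈ s.powerset, trPow K (reduced (proj (φ l)) α) := by
    simp only [Finset.mul_sum]
    rw [Finset.sum_comm]
    refine Finset.sum_le_sum fun α _ => ?_
    rw [← homTrPow_of_trace_eq_one (trace_reduced_proj hψ α)]
    exact P.homTrPow_reduced_le hK α ψ p φ hp hφ h
  have e : ∑ l, p l * gce K (φ l) s = 1 / (K - 1) * (1 - 1 / 2 ^ s.card *
      ∑ l, p l * ∑ α ∈ s.powerset, trPow K (reduced (proj (φ l)) α)) := by
    have e' : ∀ l, p l * gce K (φ l) s = 1 / (K - 1) * (p l - 1 / 2 ^ s.card *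
        (p l * ∑ α ∈ s.powerset, trPow K (reduced (proj (φ l)) α))) := fun l => by
      rw [gce]
      ring
    rw [Finset.sum_congr rfl fun l _ => e' l, ← Finset.mul_sum, Finset.sum_sub_distrib,
      ← Finset.mul_sum, P.sum_prob_eq_one hψ hφ h]
  rw [e, gce]
  gcongr

end GCEProperties

end GCE

end

theorem theorem1 (n : ℕ) (K : ℝ) (hK : 1 < K) :
    -- the GCE does not increase on average under LOCC transformations between pure states
    (∀ (s : Finset (Fin n)) (ι : Type) [Fintype ι] [DecidableEq ι]
        (P : GCE.LOCC ι (GCE.qubits n) (GCE.qubits n))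
        (ψ : GCE.Ket (GCE.qubits n)) (p : ι → ℝ) (φ : ι → GCE.Ket (GCE.qubits n)),
        ‖ψ‖ = 1 → (∀ l, 0 ≤ p l) → (∀ l, ‖φ l‖ = 1) →
        (∀ l, P.output (GCE.proj ψ) l = (p l : ℂ) • GCE.proj (φ l)) →
        ∑ l, p l * GCE.gce K (φ l) s ≤ GCE.gce K ψ s) ∧
    -- it vanishes on fully product states
    (∀ (s : Finset (Fin n)) (φ : Fin n → EuclideanSpace ℂ (Fin 2)), (∀ j, ‖φ j‖ = 1) →
        GCE.gce K (GCE.productKet (d := GCE.qubits n) φ) s = 0) ∧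
    -- it is continuous in the trace distance
    (∀ (s : Finset (Fin n)) (ψ ψ' : GCE.Ket (GCE.qubits n)) (ε : ℝ), ‖ψ‖ = 1 → ‖ψ'‖ = 1 →
        GCE.traceDist ψ ψ' ≤ ε →
        |GCE.gce K ψ s - GCE.gce K ψ' s| ≤ 2 * K / (K - 1) * ε) ∧
    -- removing a single qubit from the full set does not change it
    (∀ (ψ : GCE.Ket (GCE.qubits n)) (n₀ : Fin n), ‖ψ‖ = 1 →
        GCE.gce K ψ Finset.univ = GCE.gce K ψ (Finset.univ \ {n₀})) := by
  refine ⟨fun s ι _ _ P ψ p φ hψ hp hφ h => P.sum_gce_le hK s hψ hp hφ h,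
    fun s φ h => GCE.gce_productKet hK h s, fun s ψ ψ' ε hψ hψ' h => ?_,
    fun ψ n₀ _ => GCE.gce_univ_eq_gce_sdiff_singleton hK ψ n₀⟩
  have hc : 0 ≤ 2 * K / (K - 1) := div_nonneg (by linarith) (by linarith)
  rw [abs_sub_le_iff]
  refine ⟨(GCE.gce_sub_le hK hψ hψ' s).trans (mul_le_mul_of_nonneg_left ?_ hc),
    (GCE.gce_sub_le hK hψ' hψ s).trans (mul_le_mul_of_nonneg_left h hc)⟩
  rwa [GCE.traceDist_comm]
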